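/- Let $\Gamma$ be a subgroup of finite index in $SL(2,\mathbb{Z})$ and let $\phi:\Gamma\to\Gamma$ be a non-trivial group homomorphism (that is, $\phi$ does not send every element to the identity). Let $S$ be an infinite set of primes, and suppose that for every $p\in S$ there is a group homomorphism $\phi_p: SL(2,\mathbb{Z}/p)\to SL(2,\mathbb{Z}/p)$ such that $\phi(\gamma) \bmod p = \phi_p(\gamma \bmod p)$ for all $\gamma\in\Gamma$. Then $\phi$ is an automorphism of $\Gamma$, and there is an element $g\in GL(2,\mathbb{Q})$ such that $\phi(\gamma)=g\gamma g^{-1}$ in $GL(2,\mathbb{Q})$ for all $\gamma\in\Gamma$. -/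

import Mathlib

open scoped MatrixGroups

/-- The homomorphism `φ : Γ → Γ` descends modulo `p`: there is a homomorphism `φp` from
`SL(2, ℤ/p)` to itself with `φ γ mod p = φp (γ mod p)` for every `γ ∈ Γ`. -/
def DescendsMod (Γ : Subgroup SL(2, ℤ)) (φ : Γ →* Γ) (p : ℕ) : Prop :=
  ∃ φp : SL(2, ZMod p) →* SL(2, ZMod p), ∀ γ : Γ,
    Matrix.SpecialLinearGroup.map (Int.castRingHom (ZMod p)) (φ γ : SL(2, ℤ)) =
      φp (Matrix.SpecialLinearGroup.map (Int.castRingHom (ZMod p)) (γ : SL(2, ℤ)))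

/-- The inclusion of `SL(2, ℤ)` in `GL(2, ℚ)`. -/
def slToGLRat : SL(2, ℤ) →* GL (Fin 2) ℚ :=
  Matrix.SpecialLinearGroup.toGL.comp (Matrix.SpecialLinearGroup.map (Int.castRingHom ℚ))

/-!
The idea is that `φ` preserves traces, that trace-preserving homomorphisms are conjugations, and
that conjugation cannot shrink a group of finite index in `SL(2, ℤ)`.

*Traces.* For `p ∈ S` let `ψ : SL(2, ℤ) → SL(2, ℤ/p)` be `φ_p` composed with reduction. If `p` is
large then `ψ` is non-trivial, because `φ` is, and `ψ(T)` has order dividing `p`, so it is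
unipotent. The same holds for the lower triangular elementary matrix `L = S T⁻¹ S⁻¹`. As
`S⁴ = 1`, the square of `ψ(S)` is `1` or `-1`. In the first case `ψ(S)` would be central, and
`S = T⁻¹ L T⁻¹` would give `ψ(T)⁶ = 1`, which is impossible for `p ≥ 5`. So `ψ(S)² = -1`, whence
`trace ψ(S) = 0`, and this says exactly that `trace (ψ(T) ψ(L)) = 3 = trace (T L)`. Two unipotent
matrices are determined up to simultaneous conjugation by the trace of their product, if that is
not `2` (`exists_intertwining_of_trace_mul`), so `ψ` is reduction followed by
conjugation by an element of `GL(2, ℤ/p)` (`trace_map_eq_of_map_T_pow_eq_one`). Hence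
`trace φ(γ) ≡ trace γ` modulo infinitely many primes, and `trace φ(γ) = trace γ`.

*Conjugation.* The group `Γ` contains the elementary matrices `t`, `l` with some off-diagonal entry
`n ≠ 0`, and the same criterion over `ℚ` provides `g` that conjugates `t`, `l` to their images. As
`1, t, l, t l` span the matrix algebra and the trace form is nondegenerate, `g` conjugates every
`γ` to `φ(γ)` (`exists_conj_of_trace_eq`). In particular `φ` is injective.

*Surjectivity.* Let `A` be the subring of `M₂(ℤ)` generated by `Γ`. Conjugation by `g` maps `A` into
itself and preserves the trace form, which is nondegenerate on `A`. Taking the determinant of the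
Gram matrix shows that it maps `A` onto itself. Therefore it permutes the group `G` of elements of
`A` of determinant one. Since `g Γ g⁻¹ ≤ Γ ≤ G = g G g⁻¹` and `Γ` has finite index in `G`, a
comparison of indices gives `g Γ g⁻¹ = Γ` (`conj_smul_eq_of_le`).
-/

open scoped Pointwise
open Matrix ModularGroup

/-! ### Matrices of size two and their traces -/

/-- Two unipotent matrices `X`, `Y` with `trace (X * Y) = 2 + n ^ 2`, where `n ≠ 0`, are
simultaneously conjugate to the elementary matrices with off-diagonal entry `n`. -/
theorem exists_intertwining_of_trace_mul {K : Type*} [Field K] {X Y : Matrix (Fin 2) (Fin 2) K}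
    {n : K} (hn : n ≠ 0) (hX : X.det = 1) (hX2 : X.trace = 2) (hY : Y.det = 1)
    (hY2 : Y.trace = 2) (hXY : (X * Y).trace = 2 + n ^ 2) :
    ∃ P : GL (Fin 2) K, X * P.1 = P.1 * !![1, n; 0, 1] ∧ Y * P.1 = P.1 * !![1, 0; n, 1] := by
  obtain ⟨a, b, c, a', rfl⟩ : ∃ a b c a', X = !![1 + a, b; c, 1 + a'] :=
    ⟨X 0 0 - 1, X 0 1, X 1 0, X 1 1 - 1, by ext i j; fin_cases i <;> fin_cases j <;> simp⟩
  obtain ⟨d, e, f, d', rfl⟩ : ∃ d e f d', Y = !![1 + d, e; f, 1 + d'] :=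
    ⟨Y 0 0 - 1, Y 0 1, Y 1 0, Y 1 1 - 1, by ext i j; fin_cases i <;> fin_cases j <;> simp⟩
  simp only [trace_fin_two_of, det_fin_two_of, mul_fin_two] at hX hX2 hY hY2 hXY
  obtain rfl : a' = -a := by linear_combination hX2
  obtain rfl : d' = -d := by linear_combination hY2
  have hE : a ^ 2 + b * c = 0 := by linear_combination -hX
  have hF : d ^ 2 + e * f = 0 := by linear_combination -hY
  have hEF : 2 * a * d + b * f + c * e = n ^ 2 := by linear_combination hXY
  -- The columns of `P` are `n • u` and `(Y - 1) u`, where `u` is a nonzero column of `X - 1`.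
  have key : ∀ u v : K, a * u + b * v = 0 → c * u - a * v = 0 →
      a * (d * u + e * v) + b * (f * u - d * v) = n ^ 2 * u →
      c * (d * u + e * v) - a * (f * u - d * v) = n ^ 2 * v →
      u * (f * u - d * v) - v * (d * u + e * v) ≠ 0 →
      ∃ P : GL (Fin 2) K, !![1 + a, b; c, 1 + -a] * P.1 = P.1 * !![1, n; 0, 1] ∧
        !![1 + d, e; f, 1 + -d] * P.1 = P.1 * !![1, 0; n, 1] := by
    intro u v h1 h2 h3 h4 h5
    refine ⟨GeneralLinearGroup.mkOfDetNeZero !![n * u, d * u + e * v; n * v, f * u - d * v] ?_,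
      ?_, ?_⟩
    · rw [det_fin_two_of]
      exact fun h ↦ h5 (mul_left_cancel₀ hn (by linear_combination h))
    · change _ * !![n * u, d * u + e * v; n * v, f * u - d * v] =
        !![n * u, d * u + e * v; n * v, f * u - d * v] * _
      ext i j
      fin_cases i <;> fin_cases j <;> simp [mul_apply]
      · linear_combination n * h1
      · linear_combination h3
      · linear_combination n * h2
      · linear_combination h4
    · change _ * !![n * u, d * u + e * v; n * v, f * u - d * v] =
        !![n * u, d * u + e * v; n * v, f * u - d * v] * _
      ext i j
      fin_cases i <;> fin_cases j <;> simp [mul_apply]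
      · ring
      · linear_combination u * hF
      · ring
      · linear_combination v * hF
  by_cases hc : c = 0
  · subst hc
    have ha : a = 0 := by simpa using hE
    subst ha
    have hb : b * f = n ^ 2 := by linear_combination hEF
    have hb0 : b ≠ 0 := by rintro rfl; exact hn (by simpa using hb.symm)
    refine key b 0 (by ring) (by ring) (by linear_combination b * hb) (by ring) ?_
    have : b * (f * b - d * 0) - 0 * (d * b + e * 0) = b * n ^ 2 := by linear_combination b * hb
    rw [this]
    positivity
  · refine key a c (by linear_combination hE) (by ring) (by linear_combination a * hEF - d * hE)
      (by linear_combination c * hEF - f * hE) ?_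
    have : a * (f * a - d * c) - c * (d * a + e * c) = -(c * n ^ 2) := by
      linear_combination -c * hEF + f * hE
    rw [this]
    exact neg_ne_zero.2 (mul_ne_zero hc (pow_ne_zero _ hn))

/-- The Cayley–Hamilton theorem for a `2 × 2` matrix of determinant one. -/
theorem sq_fin_two_of_det_eq_one {R : Type*} [CommRing R] {X : Matrix (Fin 2) (Fin 2) R}
    (hX : X.det = 1) : X * X = X.trace • X - 1 := by
  rw [det_fin_two] at hX
  ext i j
  fin_cases i <;> fin_cases j <;> simp [mul_apply, Fin.sum_univ_two, trace_fin_two]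
  · linear_combination -hX
  · ring
  · ring
  · linear_combination -hX

/-- In characteristic `p`, a matrix `X` with `X ^ p = 1` is unipotent, as
`(X - 1) ^ p = X ^ p - 1`. -/
theorem trace_eq_two_of_pow_char_eq_one {p : ℕ} [Fact p.Prime] {X : Matrix (Fin 2) (Fin 2) (ZMod p)}
    (hX : X ^ p = 1) : X.trace = 2 := by
  have h : IsNilpotent (X - 1) :=
    ⟨p, by rw [sub_pow_char_of_commute p (Commute.one_right X), hX, one_pow, sub_self]⟩
  have := (isNilpotent_trace_of_isNilpotent h).eq_zero
  rw [trace_sub, trace_one, sub_eq_zero] at this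
  simpa using this

/-- An element of `SL(2, K)` of order dividing two is central, if `2 ≠ 0`. -/
theorem eq_one_or_eq_neg_one_of_mul_self {K : Type*} [Field K] (h2 : (2 : K) ≠ 0) {x : SL(2, K)}
    (hx : x * x = 1) : x = 1 ∨ x = -1 := by
  have h := sq_fin_two_of_det_eq_one x.2
  have hx' : (x : Matrix (Fin 2) (Fin 2) K) * x = 1 := congrArg Subtype.val hx
  rw [hx'] at h
  set t := (x : Matrix (Fin 2) (Fin 2) K).trace with ht
  have hd := x.2
  rw [det_fin_two] at hd
  rw [trace_fin_two] at ht
  have h00 := congrFun₂ h 0 0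
  have h01 := congrFun₂ h 0 1
  have h10 := congrFun₂ h 1 0
  have h11 := congrFun₂ h 1 1
  simp at h00 h01 h10 h11
  have ht0 : t ≠ 0 := fun h0 ↦ h2 (by rw [h0] at h00; linear_combination h00)
  have e01 : x.1 0 1 = 0 := by simpa [ht0] using h01
  have e10 : x.1 1 0 = 0 := by simpa [ht0] using h10
  have e : x.1 0 0 = x.1 1 1 := mul_left_cancel₀ ht0 (by linear_combination h11 - h00)
  have hs : x.1 0 0 * x.1 0 0 = 1 := by
    linear_combination hd + x.1 1 0 * e01 + x.1 0 0 * e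
  rcases mul_self_eq_one_iff.1 hs with h0 | h0
  · left
    ext i j
    fin_cases i <;> fin_cases j <;> simp [e01, e10, h0, ← e]
  · right
    ext i j
    fin_cases i <;> fin_cases j <;> simp [e01, e10, h0, ← e]

/-- If `n ≠ 0`, a `2 × 2` matrix is determined by the traces of its products with `1`, the two
elementary matrices with off-diagonal entry `n`, and their product. -/
theorem eq_of_trace_mul_eq {R : Type*} [CommRing R] [IsDomain R] {n : R} (hn : n ≠ 0)
    {X Y : Matrix (Fin 2) (Fin 2) R} (h1 : X.trace = Y.trace)
    (hT : (X * !![1, n; 0, 1]).trace = (Y * !![1, n; 0, 1]).trace)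
    (hL : (X * !![1, 0; n, 1]).trace = (Y * !![1, 0; n, 1]).trace)
    (hTL : (X * (!![1, n; 0, 1] * !![1, 0; n, 1])).trace =
      (Y * (!![1, n; 0, 1] * !![1, 0; n, 1])).trace) : X = Y := by
  simp only [trace_fin_two, mul_apply, Fin.sum_univ_two, of_apply, cons_val', cons_val_zero,
    cons_val_one, cons_val_fin_one] at h1 hT hL hTL
  have h10 : X 1 0 = Y 1 0 := mul_left_cancel₀ hn (by linear_combination hT - h1)
  have h01 : X 0 1 = Y 0 1 := mul_left_cancel₀ hn (by linear_combination hL - h1)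
  have h00 : X 0 0 = Y 0 0 := mul_left_cancel₀ (pow_ne_zero 2 hn)
    (by linear_combination hTL - h1 - n * h10 - n * h01)
  have h11 : X 1 1 = Y 1 1 := by linear_combination h1 - h00
  ext i j
  fin_cases i <;> fin_cases j <;> assumption

/-! ### Homomorphisms from `SL(2, ℤ)` to `SL(2, ℤ/p)` -/

theorem S_eq_T_mul : S = T⁻¹ * (S * T⁻¹ * S⁻¹) * T⁻¹ := by
  ext i j
  fin_cases i <;> fin_cases j <;> simp [coe_S, coe_T, adjugate_fin_two,
    mul_apply, Fin.sum_univ_two]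

theorem coe_S_mul_T_inv_mul_S_inv :
    (S * T⁻¹ * S⁻¹ : SL(2, ℤ)).1 = !![1, 0; 1, 1] := by
  ext i j
  fin_cases i <;> fin_cases j <;> simp [coe_S, coe_T, adjugate_fin_two,
    mul_apply, Fin.sum_univ_two]

/-- A homomorphism out of `SL(2, ℤ)` is determined by the images of the two elementary unipotent
matrices. -/
theorem hom_ext_of_elementary {M : Type*} [Group M] {f g : SL(2, ℤ) →* M} (hT : f T = g T)
    (hL : f (S * T⁻¹ * S⁻¹) = g (S * T⁻¹ * S⁻¹)) : f = g := by
  refine MonoidHom.eq_of_eqOn_dense SpecialLinearGroup.SL2Z_generators ?_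
  rintro x (rfl | rfl)
  · rw [S_eq_T_mul, map_mul, map_mul, map_mul g, map_mul g, hL, map_inv, map_inv, hT]
  · exact hT

/-- A non-trivial homomorphism from `SL(2, ℤ)` to `SL(2, ℤ/p)` that kills `T ^ p` is conjugate to
reduction modulo `p`; in particular it respects traces. -/
theorem trace_map_eq_of_map_T_pow_eq_one {p : ℕ} [Fact p.Prime] (hp : 5 ≤ p)
    {ψ : SL(2, ℤ) →* SL(2, ZMod p)}
    (hψ : ψ ≠ 1) (hT : ψ T ^ p = 1) (x : SL(2, ℤ)) :
    (ψ x).1.trace = ((x.1.trace : ℤ) : ZMod p) := by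
  have hpr : p.Prime := Fact.out
  have h2 : (2 : ZMod p) ≠ 0 := by
    intro h
    have := (ZMod.natCast_eq_zero_iff 2 p).1 (by exact_mod_cast h)
    exact absurd (Nat.le_of_dvd (by norm_num) this) (by lia)
  have ht1 : ψ T ≠ 1 := fun h ↦ hψ (hom_ext_of_elementary (by simp [h]) (by simp [h]))
  set t := ψ T with ht
  set s := ψ S with hs
  set l := ψ (S * T⁻¹ * S⁻¹) with hl
  have hlc : l = s * t⁻¹ * s⁻¹ := by simp [hl, hs, ht]
  have hstl : s = t⁻¹ * l * t⁻¹ := by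
    rw [hs, S_eq_T_mul, map_mul, map_mul, map_inv]
  have hlp : l ^ p = 1 := by rw [hlc, conj_pow, inv_pow, hT]; simp
  have hS4 : (S * S) * (S * S) = (1 : SL(2, ℤ)) := by
    ext i j
    fin_cases i <;> fin_cases j <;> simp [coe_S, mul_apply, Fin.sum_univ_two]
  have hs4 : (s * s) * (s * s) = 1 := by
    rw [hs, ← map_mul, ← map_mul, hS4, map_one]
  have hss : s * s = -1 := by
    refine (eq_one_or_eq_neg_one_of_mul_self h2 hs4).resolve_left fun h ↦ ht1 ?_
    -- If `s * s = 1` then `s` is central, so that `l = t⁻¹` and `s = t⁻³`.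
    have hst : s = t⁻¹ * t⁻¹ * t⁻¹ := by
      have : s * t⁻¹ * s⁻¹ = t⁻¹ := by
        rcases eq_one_or_eq_neg_one_of_mul_self h2 h with h | h <;> rw [h] <;> simp
      rw [hlc, this] at hstl
      exact hstl
    have h6 : t ^ 6 = 1 := by
      rw [hst] at h
      have : (t ^ 6)⁻¹ = 1 := by rw [← h]; group
      exact inv_eq_one.1 this
    have hcop : Nat.Coprime 6 p := by
      refine Nat.Coprime.symm ((Nat.Prime.coprime_iff_not_dvd hpr).2 fun h ↦ ?_)
      have := Nat.le_of_dvd (by norm_num) h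
      interval_cases p
      · omega
      · norm_num at hpr
    have := (Nat.dvd_gcd (orderOf_dvd_of_pow_eq_one h6) (orderOf_dvd_of_pow_eq_one hT))
    rw [hcop.gcd_eq_one, Nat.dvd_one, orderOf_eq_one_iff] at this
    exact this
  have coe_pow_one {y : SL(2, ZMod p)} (h : y ^ p = 1) : y.1 ^ p = 1 :=
    (Matrix.SpecialLinearGroup.coe_pow y p).symm.trans (congrArg Subtype.val h)
  have htt := trace_eq_two_of_pow_char_eq_one (coe_pow_one hT)
  have hlt := trace_eq_two_of_pow_char_eq_one (coe_pow_one hlp)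
  have hst0 : s.1.trace = 0 := by
    have h := sq_fin_two_of_det_eq_one s.2
    have hs' : s.1 * s.1 = -1 :=
      (congrArg Subtype.val hss).trans (by simp)
    rw [hs'] at h
    have h' : s.1.trace • s.1 = 0 := by
      rw [eq_sub_iff_add_eq] at h; rw [← h]; simp
    refine (smul_eq_zero.1 h').resolve_right fun h0 ↦ ?_
    have := s.2
    rw [h0] at this
    simp at this
  have htl : (t.1 * l.1).trace = 2 + 1 ^ 2 := by
    have htinv : t⁻¹.1 = (2 : ZMod p) • 1 - t.1 := by
      refine (Matrix.SpecialLinearGroup.coe_inv t).trans ?_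
      rw [← htt]
      ext i j
      fin_cases i <;> fin_cases j <;> simp [adjugate_fin_two, trace_fin_two]
    have htt2 := sq_fin_two_of_det_eq_one t.2
    rw [htt] at htt2
    -- `trace s = trace (t⁻² l)`, and `t⁻² = 3 - 2 t` as `t` is unipotent.
    have : s.1.trace = 3 * l.1.trace - 2 * (t.1 * l.1).trace := by
      have hst' : s.1 = t⁻¹.1 * l.1 * t⁻¹.1 := congrArg Subtype.val hstl
      rw [hst', trace_mul_comm, ← mul_assoc, htinv]
      have : ((2 : ZMod p) • (1 : Matrix (Fin 2) (Fin 2) (ZMod p)) - t.1) * ((2 : ZMod p) • 1 - t.1)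
          = (3 : ZMod p) • 1 - (2 : ZMod p) • t.1 := by
        rw [sub_mul, mul_sub, mul_sub, htt2]
        simp only [smul_mul_assoc, one_mul, mul_smul_comm, mul_one]
        module
      rw [this, sub_mul, trace_sub, smul_mul_assoc, one_mul, smul_mul_assoc, trace_smul,
        trace_smul, smul_eq_mul, smul_eq_mul]
    rw [hst0, hlt] at this
    refine mul_left_cancel₀ h2 ?_
    linear_combination this
  obtain ⟨P, hPt, hPl⟩ := exists_intertwining_of_trace_mul one_ne_zero t.2 htt l.2 hlt htl
  have key : Matrix.SpecialLinearGroup.toGL.comp ψ =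
      (MulAut.conj P).toMonoidHom.comp
        (Matrix.SpecialLinearGroup.toGL.comp
          (Matrix.SpecialLinearGroup.map (Int.castRingHom (ZMod p)))) := by
    refine hom_ext_of_elementary ?_ ?_
    · refine eq_mul_inv_of_mul_eq (Units.ext ?_)
      refine hPt.trans ?_
      change _ = P.1 * _
      congr 1
      ext i j
      fin_cases i <;> fin_cases j <;> simp [coe_T]
    · refine eq_mul_inv_of_mul_eq (Units.ext ?_)
      refine hPl.trans ?_
      change _ = P.1 * (Int.castRingHom (ZMod p)).mapMatrix (S * T⁻¹ * S⁻¹).1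
      rw [coe_S_mul_T_inv_mul_S_inv]
      congr 1
      ext i j
      fin_cases i <;> fin_cases j <;> simp
  have hx := congrArg (fun g : GL (Fin 2) (ZMod p) ↦ g.1.trace) (DFunLike.congr_fun key x)
  refine hx.trans ((trace_units_conj P _).trans ?_)
  simp [trace_fin_two]

/-- Traces are preserved modulo the large primes of the infinite set `S`, hence preserved. -/
theorem trace_eq_of_descendsMod {Γ : Subgroup SL(2, ℤ)} {φ : Γ →* Γ} (hφ : φ ≠ 1)
    {S : Set ℕ} (hS : S.Infinite) (hprime : ∀ p ∈ S, p.Prime)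
    (hdesc : ∀ p ∈ S, DescendsMod Γ φ p) (γ : Γ) : (φ γ).1.1.trace = γ.1.1.trace := by
  have eq_zero {p : ℕ} {z : ℤ} (hz : (z : ZMod p) = 0) (hp : z.natAbs < p) : z = 0 :=
    Int.eq_zero_of_dvd_of_natAbs_lt_natAbs ((ZMod.intCast_zmod_eq_zero_iff_dvd z p).1 hz)
      (by simpa using hp)
  obtain ⟨δ, hδ⟩ := DFunLike.ne_iff.1 hφ
  obtain ⟨i, j, hij⟩ : ∃ i j, (φ δ).1.1 i j ≠ (1 : Matrix (Fin 2) (Fin 2) ℤ) i j := by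
    by_contra! h
    exact hδ (Subtype.ext (Subtype.ext (by ext i j; exact h i j)))
  -- Choose `p` so large that neither `φ δ` and `1`, nor the two traces, if distinct, can become
  -- equal modulo `p`.
  obtain ⟨p, hpS, hp⟩ := hS.exists_gt (max 5 (max
    ((φ δ).1.1 i j - (1 : Matrix (Fin 2) (Fin 2) ℤ) i j).natAbs
    ((φ γ).1.1.trace - γ.1.1.trace).natAbs))
  simp only [max_lt_iff] at hp
  have : Fact p.Prime := ⟨hprime p hpS⟩
  obtain ⟨φp, hφp⟩ := hdesc p hpS
  let ψ := φp.comp (Matrix.SpecialLinearGroup.map (Int.castRingHom (ZMod p)))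
  have hψ : ψ ≠ 1 := by
    intro h
    have h1 := (hφp δ).trans (DFunLike.congr_fun h (δ : SL(2, ℤ)))
    have h2 : (((φ δ).1.1 i j : ℤ) : ZMod p) = (1 : Matrix (Fin 2) (Fin 2) (ZMod p)) i j :=
      congrFun₂ (congrArg Subtype.val h1) i j
    refine hij (sub_eq_zero.1 (eq_zero (p := p) ?_ hp.2.1))
    rw [Int.cast_sub, h2, sub_eq_zero, one_apply, one_apply]
    split_ifs <;> simp
  have hT : ψ T ^ p = 1 := by
    rw [← map_pow]
    have : Matrix.SpecialLinearGroup.map (Int.castRingHom (ZMod p)) (T ^ p) = 1 := by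
      have h := coe_T_zpow (p : ℤ)
      rw [zpow_natCast] at h
      refine Subtype.ext ?_
      change (Int.castRingHom (ZMod p)).mapMatrix (T ^ p).1 = 1
      rw [h]
      ext i j
      fin_cases i <;> fin_cases j <;> simp
    change φp (Matrix.SpecialLinearGroup.map (Int.castRingHom (ZMod p)) (T ^ p)) = 1
    rw [this, map_one]
  have h := trace_map_eq_of_map_T_pow_eq_one hp.1.le hψ hT γ
  have h' : (ψ γ).1.trace = (((φ γ).1.1.trace : ℤ) : ZMod p) := by
    change (φp _).1.trace = _
    rw [← hφp]
    simp [trace_fin_two]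
  refine sub_eq_zero.1 (eq_zero (p := p) ?_ hp.2.2)
  rw [Int.cast_sub, ← h', h, sub_self]

/-! ### Trace-preserving homomorphisms are conjugations -/

theorem exists_elementary_mem (Γ : Subgroup SL(2, ℤ)) (hΓ : Γ.FiniteIndex) :
    ∃ n : ℤ, n ≠ 0 ∧ ∃ t ∈ Γ, ∃ l ∈ Γ, t.1 = !![1, n; 0, 1] ∧ l.1 = !![1, 0; n, 1] := by
  obtain ⟨a, ha, -, hta⟩ := Subgroup.exists_pow_mem_of_index_ne_zero hΓ.index_ne_zero T
  obtain ⟨b, hb, -, hlb⟩ :=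
    Subgroup.exists_pow_mem_of_index_ne_zero hΓ.index_ne_zero (S * T⁻¹ * S⁻¹)
  refine ⟨a * b, by positivity, T ^ ((a : ℤ) * b), ?_, (S * T⁻¹ * S⁻¹) ^ ((b : ℤ) * a), ?_, ?_, ?_⟩
  · rw [_root_.zpow_mul, zpow_natCast, zpow_natCast]
    exact Γ.pow_mem hta b
  · rw [_root_.zpow_mul, zpow_natCast, zpow_natCast]
    exact Γ.pow_mem hlb a
  · exact_mod_cast coe_T_zpow ((a : ℤ) * b)
  · rw [conj_zpow, _root_.inv_zpow', mul_comm (b : ℤ)]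
    have h := coe_T_zpow (-((a : ℤ) * b))
    set u := T ^ (-((a : ℤ) * b))
    ext i j
    fin_cases i <;> fin_cases j <;>
      simp [coe_S, h, adjugate_fin_two, mul_apply, Fin.sum_univ_two]

theorem coe_slToGLRat (x : SL(2, ℤ)) :
    (slToGLRat x).1 = (Int.castRingHom ℚ).mapMatrix x.1 := rfl

theorem mapMatrix_intCast_injective :
    Function.Injective ((Int.castRingHom ℚ).mapMatrix (m := Fin 2)) :=
  Matrix.map_injective Int.cast_injective

theorem slToGLRat_injective : Function.Injective slToGLRat := fun _ _ h ↦
  Subtype.ext (mapMatrix_intCast_injective (congrArg Units.val h))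

/-- A trace-preserving endomorphism of a subgroup of finite index in `SL(2, ℤ)` is conjugation by an
element of `GL(2, ℚ)`. -/
theorem exists_conj_of_trace_eq (Γ : Subgroup SL(2, ℤ)) (hΓ : Γ.FiniteIndex) (φ : Γ →* Γ)
    (htr : ∀ γ, (φ γ).1.1.trace = γ.1.1.trace) :
    ∃ g : GL (Fin 2) ℚ, ∀ γ : Γ,
      slToGLRat (φ γ : SL(2, ℤ)) = g * slToGLRat (γ : SL(2, ℤ)) * g⁻¹ := by
  obtain ⟨n, hn, t, ht, l, hl, htc, hlc⟩ := exists_elementary_mem Γ hΓ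
  have hnq : (n : ℚ) ≠ 0 := by exact_mod_cast hn
  let ρ : Γ →* GL (Fin 2) ℚ := slToGLRat.comp Γ.subtype
  have htrq (γ : Γ) : (ρ (φ γ)).1.trace = (ρ γ).1.trace := by
    have := congrArg (Int.cast : ℤ → ℚ) (htr γ)
    simpa [ρ, coe_slToGLRat, trace_fin_two] using this
  have hdet (γ : Γ) : (ρ γ).1.det = 1 := by
    change ((Int.castRingHom ℚ).mapMatrix γ.1.1).det = 1
    rw [← RingHom.map_det, γ.1.2, map_one]
  let t' : Γ := ⟨t, ht⟩
  let l' : Γ := ⟨l, hl⟩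
  have hρt : (ρ t').1 = !![1, (n : ℚ); 0, 1] := by
    change (Int.castRingHom ℚ).mapMatrix t.1 = _
    rw [htc]
    ext i j
    fin_cases i <;> fin_cases j <;> simp
  have hρl : (ρ l').1 = !![1, 0; (n : ℚ), 1] := by
    change (Int.castRingHom ℚ).mapMatrix l.1 = _
    rw [hlc]
    ext i j
    fin_cases i <;> fin_cases j <;> simp
  have htl : ((ρ (φ t')).1 * (ρ (φ l')).1).trace = 2 + (n : ℚ) ^ 2 := by
    rw [← Units.val_mul, ← map_mul, ← map_mul, htrq, map_mul, Units.val_mul, hρt, hρl]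
    simp [trace_fin_two]
    ring
  obtain ⟨g, hgt, hgl⟩ := exists_intertwining_of_trace_mul hnq (hdet (φ t'))
    (by rw [htrq, hρt]; simp [trace_fin_two]; norm_num) (hdet (φ l'))
    (by rw [htrq, hρl]; simp [trace_fin_two]; norm_num) htl
  have hgt' : ρ (φ t') = g * ρ t' * g⁻¹ :=
    eq_mul_inv_of_mul_eq (Units.ext (by rw [Units.val_mul, Units.val_mul, hgt, hρt]))
  have hgl' : ρ (φ l') = g * ρ l' * g⁻¹ :=
    eq_mul_inv_of_mul_eq (Units.ext (by rw [Units.val_mul, Units.val_mul, hgl, hρl]))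
  refine ⟨g, fun γ ↦ ?_⟩
  -- Compare `g⁻¹ φ(γ) g` and `γ` through their traces against `1`, `t`, `l` and `t l`.
  have key (δ : Γ) (hδ : ρ (φ δ) = g * ρ δ * g⁻¹) :
      ((g⁻¹ * ρ (φ γ) * g).1 * (ρ δ).1).trace = ((ρ γ).1 * (ρ δ).1).trace := by
    have h : g⁻¹ * ρ (φ γ) * g * ρ δ = g⁻¹ * ρ (φ (γ * δ)) * (g⁻¹)⁻¹ := by
      rw [map_mul, map_mul, hδ]
      group
    rw [← Units.val_mul, h, Units.val_mul, Units.val_mul, trace_units_conj, htrq, map_mul,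
      Units.val_mul]
  suffices h : g⁻¹ * ρ (φ γ) * g = ρ γ by
    change ρ (φ γ) = g * ρ γ * g⁻¹
    rw [← h]
    group
  refine Units.ext (eq_of_trace_mul_eq hnq ?_ ?_ ?_ ?_)
  · simpa using key 1 (by simp)
  · simpa only [hρt] using key t' hgt'
  · simpa only [hρl] using key l' hgl'
  · have := key (t' * l') (by rw [map_mul, map_mul, map_mul, hgt', hgl']; group)
    simpa only [map_mul, Units.val_mul, hρt, hρl] using this

/-! ### Conjugation does not shrink a subgroup of finite index -/

/-- An isometry of a nondegenerate bilinear form on a free module of finite rank over a domain has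
determinant `±1`, by comparing Gram matrices, and so is bijective. -/
theorem bijective_of_isometry {R M : Type*} [CommRing R] [IsDomain R] [AddCommGroup M] [Module R M]
    [Module.Finite R M] [Module.Free R M] {B : LinearMap.BilinForm R M} (hB : B.Nondegenerate)
    {f : M →ₗ[R] M} (hf : ∀ x y, B (f x) (f y) = B x y) : Function.Bijective f := by
  let b := Module.Free.chooseBasis R M
  have h := LinearMap.BilinForm.toMatrix_comp b b B f f
  have hc : B.comp f f = B := by ext x y; exact hf x y
  have hdet := congrArg Matrix.det h
  rw [hc, det_mul, det_mul, det_transpose, LinearMap.det_toMatrix] at hdet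
  have hne := (LinearMap.BilinForm.nondegenerate_iff_det_ne_zero b).1 hB
  have h1 : LinearMap.det f * LinearMap.det f = 1 :=
    mul_left_cancel₀ hne (by linear_combination -hdet)
  exact (Module.End.isUnit_iff f).1
    ((LinearMap.isUnit_iff_isUnit_det f).2 (IsUnit.of_mul_eq_one _ h1))

/-- The trace form `(x, y) ↦ trace (x y)` on integral `2 × 2` matrices. -/
def intTraceForm : LinearMap.BilinForm ℤ (Matrix (Fin 2) (Fin 2) ℤ) :=
  (LinearMap.mul ℤ (Matrix (Fin 2) (Fin 2) ℤ)).compr₂ (traceLinearMap (Fin 2) ℤ ℤ)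

/-- The subring of `M₂(ℤ)` generated by a subgroup of `SL(2, ℤ)`. -/
def groupOrder (Γ : Subgroup SL(2, ℤ)) : Subalgebra ℤ (Matrix (Fin 2) (Fin 2) ℤ) :=
  Algebra.adjoin ℤ ((fun x : SL(2, ℤ) ↦ x.1) '' Γ)

/-- The trace form is nondegenerate on `groupOrder Γ` as the latter contains elementary matrices. -/
theorem nondegenerate_restrict_groupOrder (Γ : Subgroup SL(2, ℤ)) (hΓ : Γ.FiniteIndex) :
    (intTraceForm.restrict (Subalgebra.toSubmodule (groupOrder Γ))).Nondegenerate := by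
  obtain ⟨n, hn, t, ht, l, hl, htc, hlc⟩ := exists_elementary_mem Γ hΓ
  have mem {x : SL(2, ℤ)} (hx : x ∈ Γ) : x.1 ∈ groupOrder Γ :=
    Algebra.subset_adjoin ⟨x, hx, rfl⟩
  have key (x : Matrix (Fin 2) (Fin 2) ℤ) (hx : ∀ y ∈ groupOrder Γ, (x * y).trace = 0) : x = 0 := by
    refine eq_of_trace_mul_eq hn ?_ ?_ ?_ ?_
    · simpa using hx 1 (one_mem _)
    · rw [← htc, hx _ (mem ht)]; simp
    · rw [← hlc, hx _ (mem hl)]; simp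
    · rw [← htc, ← hlc, hx _ (mul_mem (mem ht) (mem hl))]; simp
  refine ⟨fun x hx ↦ Subtype.ext (key x.1 fun y hy ↦ hx ⟨y, hy⟩),
    fun x hx ↦ Subtype.ext (key x.1 fun y hy ↦ ?_)⟩
  rw [trace_mul_comm]
  exact hx ⟨y, hy⟩

/-- The subgroup of `SL(2, ℤ)` of the elements lying in a subring of `M₂(ℤ)`. It is closed under
inverses because `x⁻¹ = trace x - x`. -/
def normOneSubgroup (A : Subalgebra ℤ (Matrix (Fin 2) (Fin 2) ℤ)) : Subgroup SL(2, ℤ) where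
  carrier := {x | x.1 ∈ A}
  mul_mem' hx hy := A.mul_mem hx hy
  one_mem' := A.one_mem
  inv_mem' := by
    intro x hx
    have : x⁻¹.1 = x.1.trace • (1 : Matrix (Fin 2) (Fin 2) ℤ) - x.1 := by
      refine (Matrix.SpecialLinearGroup.coe_inv x).trans ?_
      ext i j
      rw [Matrix.sub_apply, Matrix.smul_apply]
      fin_cases i <;> fin_cases j <;> simp [adjugate_fin_two, trace_fin_two]
    change x⁻¹.1 ∈ A
    rw [this]
    exact A.sub_mem (A.smul_mem A.one_mem _) hx

theorem conj_smul_le_iff {G : Type*} [Group G] {H K : Subgroup G} {g : G} :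
    MulAut.conj g • H ≤ K ↔ ∀ h ∈ H, g * h * g⁻¹ ∈ K := by
  refine ⟨fun hle h hh ↦ hle ⟨h, hh, rfl⟩, ?_⟩
  rintro hle _ ⟨h, hh, rfl⟩
  exact hle h hh

/-- If conjugation by `g` maps `Γ` into itself, it maps the subring generated by `Γ` into itself. -/
theorem exists_groupOrder_conj {Γ : Subgroup SL(2, ℤ)} {g : GL (Fin 2) ℚ}
    (hg : MulAut.conj g • Γ.map slToGLRat ≤ Γ.map slToGLRat) :
    ∃ f : groupOrder Γ →ₗ[ℤ] groupOrder Γ, ∀ a, (Int.castRingHom ℚ).mapMatrix (f a).1 =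
      g.1 * (Int.castRingHom ℚ).mapMatrix a.1 * (g⁻¹).1 := by
  have h (a : groupOrder Γ) : ∃ a' : groupOrder Γ, (Int.castRingHom ℚ).mapMatrix a'.1 =
      g.1 * (Int.castRingHom ℚ).mapMatrix a.1 * (g⁻¹).1 := by
    obtain ⟨a, ha⟩ := a
    change ∃ a' : groupOrder Γ, (Int.castRingHom ℚ).mapMatrix a'.1 =
      g.1 * (Int.castRingHom ℚ).mapMatrix a * (g⁻¹).1
    induction ha using Algebra.adjoin_induction with
    | mem x hx =>
      obtain ⟨x, hx, rfl⟩ := hx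
      obtain ⟨y, hy, hyx⟩ := conj_smul_le_iff.1 hg _ (Subgroup.mem_map_of_mem slToGLRat hx)
      exact ⟨⟨y.1, Algebra.subset_adjoin ⟨y, hy, rfl⟩⟩, congrArg Units.val hyx⟩
    | algebraMap r =>
      refine ⟨algebraMap ℤ _ r, ?_⟩
      simp only [Algebra.algebraMap_eq_smul_one, SetLike.val_smul, OneMemClass.coe_one, map_zsmul,
        map_one, mul_smul_comm, mul_one, smul_mul_assoc, Units.mul_inv]
    | add x y _ _ hx hy =>
      obtain ⟨x', hx⟩ := hx
      obtain ⟨y', hy⟩ := hy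
      refine ⟨x' + y', ?_⟩
      rw [AddMemClass.coe_add, map_add, map_add, hx, hy, mul_add, add_mul]
    | mul x y _ _ hx hy =>
      obtain ⟨x', hx⟩ := hx
      obtain ⟨y', hy⟩ := hy
      refine ⟨x' * y', ?_⟩
      rw [MulMemClass.coe_mul, map_mul, map_mul, hx, hy]
      simp only [mul_assoc, Units.inv_mul_cancel_left]
  choose f hf using h
  refine ⟨(AddMonoidHom.mk' f fun a b ↦
    Subtype.ext (mapMatrix_intCast_injective ?_)).toIntLinearMap,
    hf⟩
  rw [AddMemClass.coe_add, map_add, hf, hf, hf, AddMemClass.coe_add, map_add, mul_add, add_mul]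

/-- A subgroup of finite index in `SL(2, ℤ)` is not conjugate to a proper subgroup of itself. The
indices are compared inside the group `G` of elements of determinant one of the subring generated
by `Γ`, which conjugation by `g` maps onto itself. -/
theorem conj_smul_eq_of_le {Γ : Subgroup SL(2, ℤ)} (hΓ : Γ.FiniteIndex) {g : GL (Fin 2) ℚ}
    (hg : MulAut.conj g • Γ.map slToGLRat ≤ Γ.map slToGLRat) :
    MulAut.conj g • Γ.map slToGLRat = Γ.map slToGLRat := by
  obtain ⟨f, hf⟩ := exists_groupOrder_conj hg
  have hisom (x y : groupOrder Γ) : ((f x).1 * (f y).1).trace = (x.1 * y.1).trace := by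
    have h : (Int.castRingHom ℚ).mapMatrix ((f x).1 * (f y).1) =
        g.1 * (Int.castRingHom ℚ).mapMatrix (x.1 * y.1) * (g⁻¹).1 := by
      rw [map_mul, map_mul, hf, hf]
      simp only [mul_assoc, Units.inv_mul_cancel_left]
    have h' := congrArg Matrix.trace h
    rw [trace_units_conj] at h'
    simp only [RingHom.mapMatrix_apply, ← AddMonoidHom.map_trace] at h'
    exact Int.cast_injective h'
  have hdet (x : groupOrder Γ) : (f x).1.det = x.1.det := by
    have h' := congrArg Matrix.det (hf x)
    rw [det_units_conj, ← RingHom.map_det, ← RingHom.map_det] at h'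
    exact Int.cast_injective h'
  have hbij : Function.Bijective f :=
    bijective_of_isometry (M := Subalgebra.toSubmodule (groupOrder Γ))
      (nondegenerate_restrict_groupOrder Γ hΓ) hisom
  have hΓA : Γ ≤ normOneSubgroup (groupOrder Γ) := fun x hx ↦ Algebra.subset_adjoin ⟨x, hx, rfl⟩
  set G := (normOneSubgroup (groupOrder Γ)).map slToGLRat with hG
  have hGle : MulAut.conj g • G ≤ G := by
    rw [conj_smul_le_iff]
    rintro _ ⟨x, hx, rfl⟩
    exact ⟨⟨(f ⟨x.1, hx⟩).1, (hdet _).trans x.2⟩, (f ⟨x.1, hx⟩).2, Units.ext (hf ⟨x.1, hx⟩)⟩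
  have hGge : G ≤ MulAut.conj g • G := by
    rintro _ ⟨x, hx, rfl⟩
    obtain ⟨y, hy⟩ := hbij.2 ⟨x.1, hx⟩
    have hy1 : y.1.det = 1 := by rw [← hdet, hy]; exact x.2
    refine ⟨slToGLRat ⟨y.1, hy1⟩, ⟨_, y.2, rfl⟩, Units.ext ?_⟩
    have := hf y
    rw [hy] at this
    exact this.symm
  have hGeq := le_antisymm hGle hGge
  have h1 := Subgroup.relIndex_mul_relIndex _ _ G hg (Subgroup.map_mono hΓA)
  have h2 := Subgroup.relIndex_pointwise_smul (MulAut.conj g) (Γ.map slToGLRat) G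
  rw [hGeq] at h2
  have h3 : (Γ.map slToGLRat).relIndex G ≠ 0 := by
    rw [hG, Subgroup.relIndex_map_map_of_injective _ _ slToGLRat_injective]
    exact Subgroup.isFiniteRelIndex_of_finiteIndex.relIndex_ne_zero
  rw [h2] at h1
  exact le_antisymm hg (Subgroup.relIndex_eq_one.1 ((mul_eq_right₀ h3).1 h1))

theorem theorem5 (Γ : Subgroup SL(2, ℤ)) (hΓ : Γ.FiniteIndex) (φ : Γ →* Γ) (hφ : φ ≠ 1)
    (S : Set ℕ) (hS : S.Infinite) (hprime : ∀ p ∈ S, p.Prime)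
    (hdesc : ∀ p ∈ S, DescendsMod Γ φ p) :
    Function.Bijective φ ∧
      ∃ g : GL (Fin 2) ℚ, ∀ γ : Γ,
        slToGLRat (φ γ : SL(2, ℤ)) = g * slToGLRat (γ : SL(2, ℤ)) * g⁻¹ := by
  obtain ⟨g, hg⟩ := exists_conj_of_trace_eq Γ hΓ φ (trace_eq_of_descendsMod hφ hS hprime hdesc)
  refine ⟨⟨fun x y hxy ↦ ?_, fun y ↦ ?_⟩, g, hg⟩
  · have h := (hg x).symm.trans ((congrArg (fun z : Γ ↦ slToGLRat z) hxy).trans (hg y))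
    exact Subtype.ext (slToGLRat_injective (mul_left_cancel (mul_right_cancel h)))
  · have hle : MulAut.conj g • Γ.map slToGLRat ≤ Γ.map slToGLRat := by
      rw [conj_smul_le_iff]
      rintro _ ⟨x, hx, rfl⟩
      exact ⟨φ ⟨x, hx⟩, (φ ⟨x, hx⟩).2, hg ⟨x, hx⟩⟩
    have hy : slToGLRat y ∈ MulAut.conj g • Γ.map slToGLRat := by
      rw [conj_smul_eq_of_le hΓ hle]
      exact Subgroup.mem_map_of_mem _ y.2
    obtain ⟨_, ⟨x, hx, rfl⟩, hxy⟩ := hy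
    exact ⟨⟨x, hx⟩, Subtype.ext (slToGLRat_injective ((hg ⟨x, hx⟩).trans hxy))⟩
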